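/- Let $(\mathcal D,\nu_D)$, $(\mathcal A,\nu_A)$, $(\Theta,\nu_\Theta)$ each be either a countable discrete set with counting measure or an interval (a product of $n$ real intervals) in $\mathbb R^n$ with Lebesgue measure. Let $u_A(a,\theta)$, $u_D(d,\theta)$ be positive measurable utilities of an Attacker and a Defender, and $p_A(\theta\mid d,a)$, $p_D(\theta\mid d,a)$ positive, jointly measurable probability densities in $\theta$ with respect to $\nu_\Theta$. Assume that $\theta\mapsto u_A(a,\theta)p_A(\theta\mid d,a)$ and $\theta\mapsto u_D(d,\theta)p_D(\theta\mid d,a)$ are integrable for all $d,a$, and put $\psi_A(d,a)=\int u_A(a,\theta)p_A(\theta\mid d,a)\,d\theta$, $\psi_D(d,a)=\int u_D(d,\theta)p_D(\theta\mid d,a)\,d\theta$. Assume that for each $d$ the best response $a^*(d)=\arg\max_a\psi_A(d,a)$ exists, is unique and depends measurably on $d$, and that $d^*_{GT}=\arg\max_d\psi_D(d,a^*(d))$ exists and is unique (so $d^*_{GT}$ is the subgame-perfect defense). Assume also that $(a,\theta)\mapsto u_A(a,\theta)p_A(\theta\mid d,a)$ is integrable for each $d$, and that $(d,\theta)\mapsto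 u_D(d,\theta)p_D(\theta\mid d,a^*(d))$ is integrable. Let $g_A(\tilde a\mid a)$ and $g_D(\tilde d\mid d)$ be symmetric proposal densities with respect to $\nu_A$ and $\nu_D$, each irreducible: from every point, every set of positive reference measure is reached with positive probability by iterating the proposal. *Inner chain for the defense $d$.* Start at an arbitrary $a^{(0)}$ and $\theta^{(0)}\sim p_A(\cdot\mid d,a^{(0)})$. From $(a,\theta)$ draw $\tilde a\sim g_A(\cdot\mid a)$, $\tilde\theta\sim p_A(\cdot\mid d,\tilde a)$, and move to $(\tilde a,\tilde\theta)$ with probability $\min\{1,u_A(\tilde a,\tilde\theta)/u_A(a,\theta)\}$; otherwise stay. After $M$ steps a mode estimator applied to $a^{(K+1)},\dots,a^{(M)}$ gives the estimated response. *Outer chain.* Start at an arbitrary $d^{(0)}$ and draw $\theta^{(0)}\sim p_D(\cdot\mid d^{(0)},\hat a(d^{(0)}))$. From $(d,\theta)$ draw $\tilde d\sim g_D(\cdot\mid d)$, take the recorded response $\hat a(\tilde d)$, draw $\tilde\theta\sim p_D(\cdot\mid\tilde d,\hat a(\tilde d))$, and move to $(\tilde d,\tilde\theta)$ with probability $\min\{1,u_D(\tilde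 d,\tilde\theta)/u_D(d,\theta)\}$; otherwise stay. The output is a mode estimator applied to $d^{(R+1)},\dots,d^{(N)}$. In the *nested chain* the recorded response to each candidate $\tilde d$ (and to $d^{(0)}$) is the limit, as $M\to\infty$, of the estimates of the inner chain for that defense. A sequence of measurable estimators is called *consistent* for the mode of a density $f$ if, along every positive Harris recurrent Markov chain on (decision, outcome) pairs whose stationary distribution has decision-marginal of density $f$, and from every starting point, the estimates from the first $N$ decision draws converge almost surely, as $N\to\infty$, to the unique maximizer of $f$ whenever it exists (independent samples are a special case). Let the inner mode estimator be consistent for the marginal density of $a$ under $\pi_A(a,\theta\mid d)\propto u_A(a,\theta)p_A(\theta\mid d,a)$, for every $d$, and the outer one for the marginal density of $d$ under $\pi_D(d,\theta\mid a^*(d))\propto u_D(d,\theta)p_D(\theta\mid d,a^*(d))$. Then: 1. For each $d$, $\pi_A(\cdot\mid d)$ is a probability distribution, it is stationary for the inner chain, its $a$-marginal density has mode $a^*(d)$, and for every burn-in $K$ the estimated response converges to $a^*(d)$ almost surely as $M\to\infty$. 2. For every measurable table of recorded responses $r:\mathcal D\to\mathcal A$ such that $(d,\theta)\mapsto u_D(d,\theta)p_D(\theta\mid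 d,r(d))$ is integrable, $\pi_D(d,\theta\mid r(d))\propto u_D(d,\theta)p_D(\theta\mid d,r(d))$ is a probability distribution and is stationary for the outer chain with $\hat a=r$. 3. The nested chain is a well-defined Markov chain on $\mathcal D\times\Theta$; $\pi_D(d,\theta\mid a^*(d))$ is a probability distribution and is stationary for it; its $d$-marginal density has mode $d^*_{GT}$; and for all initial values $d^{(0)}$ and burn-ins $R$ the mode estimates based on $d^{(R+1)},\dots,d^{(N)}$ converge to $d^*_{GT}$ almost surely as $N\to\infty$. -/

import Mathlib

open MeasureTheory ProbabilityTheory Filter Topology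

noncomputable section

/-! ### Spaces with their reference measure -/

/-- `(X, ν)` is either a countable discrete set with counting measure (so that `∫ f ∂ν = ∑ f`), or
(via the topological identification `e`) an interval `∏ i, I i` of `ℝⁿ`, with Lebesgue measure. -/
class DiscreteOrInterval (X : Type*) [TopologicalSpace X] [MeasurableSpace X]
    (ν : Measure X) : Prop where
  discrete_or_interval :
    (Countable X ∧ DiscreteTopology X ∧ ν = Measure.count) ∨
    ∃ (n : ℕ) (I : Fin n → Set ℝ) (e : X → (Fin n → ℝ)),
      (∀ i, (I i).OrdConnected) ∧ IsEmbedding e ∧ Set.range e = Set.univ.pi I ∧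
        ν = (volume : Measure (Fin n → ℝ)).comap e

instance DiscreteOrInterval.sigmaFinite {X : Type*} [TopologicalSpace X] [MeasurableSpace X]
    [BorelSpace X] (ν : Measure X) [h : DiscreteOrInterval X ν] : SigmaFinite ν := by
  rcases h.discrete_or_interval with ⟨_, _, rfl⟩ | ⟨n, I, e, hI, he, hr, rfl⟩
  · infer_instance
  · have hm : MeasurableSet (Set.range e) := by
      rw [hr]
      exact MeasurableSet.univ_pi fun i => (hI i).measurableSet
    have hme : MeasurableEmbedding e := he.measurableEmbedding hm
    refine SigmaFinite.of_map _ hme.measurable.aemeasurable ?_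
    rw [hme.map_comap]
    infer_instance

/-! ### Markov chains -/

/-- The law on `ℕ → Z` of the time-homogeneous Markov chain with transition kernel `κ` and
initial law `init`. -/
def chainLaw {Z : Type*} [MeasurableSpace Z] (init : Measure Z) (κ : Kernel Z Z)
    [IsMarkovKernel κ] : Measure (ℕ → Z) :=
  Kernel.trajMeasure (X := fun _ => Z) init
    (fun n => κ.comap (fun x => x ⟨n, Finset.mem_Iic.2 le_rfl⟩) (measurable_pi_apply _))

/-- Harris recurrence with respect to `μ`: from every starting point, every set charged by `μ`
is almost surely visited at some time `≥ 1`. -/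
def HarrisRecurrent {Z : Type*} [MeasurableSpace Z] (κ : Kernel Z Z) [IsMarkovKernel κ]
    (μ : Measure Z) : Prop :=
  ∀ S : Set Z, MeasurableSet S → 0 < μ S →
    ∀ z : Z, ∀ᵐ x ∂(chainLaw (Measure.dirac z) κ), ∃ n : ℕ, x (n + 1) ∈ S

/-! ### Mode estimation -/

/-- `m` is the (unique) mode of `f`, i.e. its unique global maximizer. -/
def IsMode {X : Type*} (f : X → ℝ) (m : X) : Prop := ∀ x, x ≠ m → f x < f m

/-- The value of the estimator `T` on the `X`-marginal draws `z^(burn+1), …, z^(total)` of a path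
`z` in `X × Y`: the first `burn` draws after the initial state are discarded. -/
def modeEstimate {X Y : Type*} (T : (n : ℕ) → (Fin n → X) → X) (burn total : ℕ)
    (z : ℕ → X × Y) : X :=
  T (total - burn) (fun i => (z (burn + 1 + i)).1)

/-- `T` is a consistent estimator of the mode of the probability density `f` (with respect to `ν`)
from marginal samples: whenever a positive Harris recurrent Markov chain on `X × Y` has a
stationary distribution with `X`-marginal `f ∂ν`, the estimates computed from the first `N`
draws of its `X`-component converge almost surely to the mode of `f`, from every starting point.
(Independent samples are the special case of a constant kernel.) -/
def IsConsistentModeEstimator {X : Type*} [TopologicalSpace X] [MeasurableSpace X]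
    (ν : Measure X) (Y : Type*) [MeasurableSpace Y] (T : (n : ℕ) → (Fin n → X) → X)
    (f : X → ℝ) : Prop :=
  (∀ n, Measurable (T n)) ∧
  ∀ m : X, IsMode f m →
    ∀ (κ : Kernel (X × Y) (X × Y)) [IsMarkovKernel κ] (μ : Measure (X × Y))
      [IsProbabilityMeasure μ],
      κ.Invariant μ → HarrisRecurrent κ μ →
      μ.fst = ν.withDensity (fun x => ENNReal.ofReal (f x)) →
      ∀ z : X × Y, ∀ᵐ x ∂(chainLaw (Measure.dirac z) κ),
        Tendsto (fun N => modeEstimate T 0 N x) atTop (𝓝 m)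

/-! ### The Metropolis–Hastings accept/reject step -/

/-- Given (current state, candidate), move to the candidate with probability `α`, else stay, where
`α = min {1, u(candidate) / u(current)}`. -/
def acceptReject {Z : Type*} [MeasurableSpace Z] (u : Z → ℝ) (hu : Measurable u) :
    Kernel (Z × Z) Z where
  toFun p := ENNReal.ofReal (min 1 (u p.2 / u p.1)) • Measure.dirac p.2
    + (1 - ENNReal.ofReal (min 1 (u p.2 / u p.1))) • Measure.dirac p.1
  measurable' := by
    have hα : Measurable fun p : Z × Z => ENNReal.ofReal (min 1 (u p.2 / u p.1)) := by fun_prop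
    refine Measure.measurable_of_measurable_coe _ fun s hs => ?_
    simp only [Measure.coe_add, Measure.coe_smul, Pi.add_apply, Pi.smul_apply, smul_eq_mul,
      Measure.dirac_apply' _ hs]
    have h1 : Measurable fun p : Z × Z => s.indicator (1 : Z → ENNReal) p.1 :=
      (measurable_one.indicator hs).comp measurable_fst
    have h2 : Measurable fun p : Z × Z => s.indicator (1 : Z → ENNReal) p.2 :=
      (measurable_one.indicator hs).comp measurable_snd
    exact (hα.mul h2).add ((measurable_const.sub hα).mul h1)

instance {Z : Type*} [MeasurableSpace Z] (u : Z → ℝ) (hu : Measurable u) :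
    IsMarkovKernel (acceptReject u hu) := by
  refine ⟨fun p => ⟨?_⟩⟩
  simp [acceptReject]

/-- One Metropolis–Hastings transition: draw a candidate from `Q`, then accept or reject it. -/
def mhKernel {Z : Type*} [MeasurableSpace Z] (u : Z → ℝ) (hu : Measurable u)
    (Q : Kernel Z Z) : Kernel Z Z :=
  acceptReject u hu ∘ₖ (Kernel.id ×ₖ Q)

instance {Z : Type*} [MeasurableSpace Z] (u : Z → ℝ) (hu : Measurable u) (Q : Kernel Z Z)
    [IsMarkovKernel Q] : IsMarkovKernel (mhKernel u hu Q) := by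
  unfold mhKernel; infer_instance

/-! ### Proposal distributions -/

/-- A proposal generating distribution `g(x̃ ∣ x)`, written `g x̃ x`, given by densities with
respect to the reference measure `ν`. -/
structure Proposal (X : Type*) [MeasurableSpace X] (ν : Measure X) where
  g : X → X → ℝ
  measurable : Measurable (fun p : X × X => g p.1 p.2)
  nonneg : ∀ y x, 0 ≤ g y x
  lintegral_eq_one : ∀ x, ∫⁻ y, ENNReal.ofReal (g y x) ∂ν = 1

namespace Proposal

variable {X : Type*} [MeasurableSpace X] {ν : Measure X}

/-- Symmetry: `g(x̃ ∣ x) = g(x ∣ x̃)`. -/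
def Symmetric (G : Proposal X ν) : Prop := ∀ x y, G.g y x = G.g x y

/-- The kernel `x ↦ g(· ∣ x) ∂ν`. -/
def kernel [SFinite ν] (G : Proposal X ν) : Kernel X X :=
  Kernel.withDensity (Kernel.const X ν) (fun x y => ENNReal.ofReal (G.g y x))

instance [SFinite ν] (G : Proposal X ν) : IsMarkovKernel G.kernel := by
  refine ⟨fun x => ⟨?_⟩⟩
  have hm : Measurable (Function.uncurry fun x y => ENNReal.ofReal (G.g y x)) :=
    (G.measurable.comp measurable_swap).ennreal_ofReal
  rw [kernel, Kernel.withDensity_apply _ hm, Kernel.const_apply,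
    withDensity_apply _ MeasurableSet.univ, Measure.restrict_univ, G.lintegral_eq_one]

end Proposal

/-! ### The sequential game -/

/-- The data `(u_A, p_A)`, `(u_D, p_D)` of a sequential defend–attack game: utilities
`u_A(a, θ)`, `u_D(d, θ)`, and outcome densities `p_A(θ ∣ d, a)`, `p_D(θ ∣ d, a)` with respect to
`νΘ`, written `pA d a θ`, `pD d a θ`. -/
structure DefendAttackGame (D A Θ : Type*) [MeasurableSpace D] [MeasurableSpace A]
    [MeasurableSpace Θ] (νΘ : Measure Θ) where
  uA : A → Θ → ℝ
  uD : D → Θ → ℝ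
  pA : D → A → Θ → ℝ
  pD : D → A → Θ → ℝ
  measurable_uA : Measurable (fun z : A × Θ => uA z.1 z.2)
  measurable_uD : Measurable (fun z : D × Θ => uD z.1 z.2)
  measurable_pA : Measurable (fun z : (D × A) × Θ => pA z.1.1 z.1.2 z.2)
  measurable_pD : Measurable (fun z : (D × A) × Θ => pD z.1.1 z.1.2 z.2)
  nonneg_pA : ∀ d a θ, 0 ≤ pA d a θ
  nonneg_pD : ∀ d a θ, 0 ≤ pD d a θ
  lintegral_pA : ∀ d a, ∫⁻ θ, ENNReal.ofReal (pA d a θ) ∂νΘ = 1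
  lintegral_pD : ∀ d a, ∫⁻ θ, ENNReal.ofReal (pD d a θ) ∂νΘ = 1

namespace DefendAttackGame

variable {D A Θ : Type*} [MeasurableSpace D] [MeasurableSpace A] [MeasurableSpace Θ]
  {νΘ : Measure Θ}

/-- The Attacker's expected utility `ψ_A(d, a) = ∫ u_A(a, θ) p_A(θ ∣ d, a) dθ`. -/
def psiA (G : DefendAttackGame D A Θ νΘ) (d : D) (a : A) : ℝ :=
  ∫ θ, G.uA a θ * G.pA d a θ ∂νΘ

/-- The Defender's expected utility `ψ_D(d, a) = ∫ u_D(d, θ) p_D(θ ∣ d, a) dθ`. -/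
def psiD (G : DefendAttackGame D A Θ νΘ) (d : D) (a : A) : ℝ :=
  ∫ θ, G.uD d θ * G.pD d a θ ∂νΘ

/-- `θ ∼ p_A(θ ∣ d, a)`, as a kernel in `(d, a)`. -/
def outcomeA [SFinite νΘ] (G : DefendAttackGame D A Θ νΘ) : Kernel (D × A) Θ :=
  Kernel.withDensity (Kernel.const (D × A) νΘ) (fun x θ => ENNReal.ofReal (G.pA x.1 x.2 θ))

/-- `θ ∼ p_D(θ ∣ d, a)`, as a kernel in `(d, a)`. -/
def outcomeD [SFinite νΘ] (G : DefendAttackGame D A Θ νΘ) : Kernel (D × A) Θ :=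
  Kernel.withDensity (Kernel.const (D × A) νΘ) (fun x θ => ENNReal.ofReal (G.pD x.1 x.2 θ))

instance [SFinite νΘ] (G : DefendAttackGame D A Θ νΘ) : IsMarkovKernel G.outcomeA := by
  refine ⟨fun x => ⟨?_⟩⟩
  rw [outcomeA, Kernel.withDensity_apply _ G.measurable_pA.ennreal_ofReal, Kernel.const_apply,
    withDensity_apply _ MeasurableSet.univ, Measure.restrict_univ, G.lintegral_pA]

instance [SFinite νΘ] (G : DefendAttackGame D A Θ νΘ) : IsMarkovKernel G.outcomeD := by
  refine ⟨fun x => ⟨?_⟩⟩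
  rw [outcomeD, Kernel.withDensity_apply _ G.measurable_pD.ennreal_ofReal, Kernel.const_apply,
    withDensity_apply _ MeasurableSet.univ, Measure.restrict_univ, G.lintegral_pD]

/-! #### Augmented distributions -/

/-- The density of `π_A(a, θ ∣ d) ∝ u_A(a, θ) p_A(θ ∣ d, a)`. -/
def augDensityA (G : DefendAttackGame D A Θ νΘ) (νA : Measure A) (d : D) (z : A × Θ) : ℝ :=
  G.uA z.1 z.2 * G.pA d z.1 z.2 / ∫ w : A × Θ, G.uA w.1 w.2 * G.pA d w.1 w.2 ∂(νA.prod νΘ)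

/-- The augmented distribution `π_A(a, θ ∣ d)`. -/
def augA (G : DefendAttackGame D A Θ νΘ) (νA : Measure A) (d : D) : Measure (A × Θ) :=
  (νA.prod νΘ).withDensity (fun z => ENNReal.ofReal (G.augDensityA νA d z))

/-- The marginal density `π_A(a ∣ d) = ∫ π_A(a, θ ∣ d) dθ`. -/
def margDensityA (G : DefendAttackGame D A Θ νΘ) (νA : Measure A) (d : D) (a : A) : ℝ :=
  ∫ θ, G.augDensityA νA d (a, θ) ∂νΘ

/-- The density of `π_D(d, θ ∣ r(d)) ∝ u_D(d, θ) p_D(θ ∣ d, r(d))`, for a response map `r`. -/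
def augDensityD (G : DefendAttackGame D A Θ νΘ) (νD : Measure D) (r : D → A) (z : D × Θ) : ℝ :=
  G.uD z.1 z.2 * G.pD z.1 (r z.1) z.2 /
    ∫ w : D × Θ, G.uD w.1 w.2 * G.pD w.1 (r w.1) w.2 ∂(νD.prod νΘ)

/-- The augmented distribution `π_D(d, θ ∣ r(d))`. -/
def augD (G : DefendAttackGame D A Θ νΘ) (νD : Measure D) (r : D → A) : Measure (D × Θ) :=
  (νD.prod νΘ).withDensity (fun z => ENNReal.ofReal (G.augDensityD νD r z))

/-- The marginal density `π_D(d ∣ r(d)) = ∫ π_D(d, θ ∣ r(d)) dθ`. -/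
def margDensityD (G : DefendAttackGame D A Θ νΘ) (νD : Measure D) (r : D → A) (d : D) : ℝ :=
  ∫ θ, G.augDensityD νD r (d, θ) ∂νΘ

/-! #### The inner chain (`solve_attacker`) -/

section Inner

variable [SFinite νΘ] {νA : Measure A} [SFinite νA]

/-- Candidate of the inner chain for the defense `d`: `ã ∼ g_A(· ∣ a)`, then
`θ̃ ∼ p_A(· ∣ d, ã)`. -/
def innerCandidate (G : DefendAttackGame D A Θ νΘ) (gA : Proposal A νA) (d : D) :
    Kernel (A × Θ) (A × Θ) :=
  ((Kernel.id ×ₖ G.outcomeA.comap (fun a => (d, a)) measurable_prodMk_left) ∘ₖ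
    gA.kernel).comap Prod.fst measurable_fst

/-- Transition kernel of the inner chain for the defense `d`. -/
def innerKernel (G : DefendAttackGame D A Θ νΘ) (gA : Proposal A νA) (d : D) :
    Kernel (A × Θ) (A × Θ) :=
  mhKernel (fun z => G.uA z.1 z.2) G.measurable_uA (G.innerCandidate gA d)

instance (G : DefendAttackGame D A Θ νΘ) (gA : Proposal A νA) (d : D) :
    IsMarkovKernel (G.innerKernel gA d) := by
  unfold innerKernel innerCandidate; infer_instance

/-- Law of the trajectory `(a^(i), θ^(i))` of the inner chain for the defense `d`, with
`a^(0) = a₀` and `θ^(0) ∼ p_A(· ∣ d, a₀)`. -/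
def innerLaw (G : DefendAttackGame D A Θ νΘ) (gA : Proposal A νA) (d : D) (a₀ : A) :
    Measure (ℕ → A × Θ) :=
  chainLaw ((G.outcomeA (d, a₀)).map (fun θ => (a₀, θ))) (G.innerKernel gA d)

/-- Law of the best response recorded by `solve_attacker` for the defense `d` when the inner chain
is run to convergence: the limit, as the number `M` of inner draws grows, of the mode estimates
from the draws `a^(K+1), …, a^(M)`. -/
def responseLaw [TopologicalSpace A] [Nonempty A] (G : DefendAttackGame D A Θ νΘ)
    (gA : Proposal A νA) (TA : (n : ℕ) → (Fin n → A) → A) (K : ℕ) (a₀ : D → A) (d : D) :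
    Measure A :=
  (G.innerLaw gA d (a₀ d)).map (fun x => limUnder atTop (fun M => modeEstimate TA K M x))

end Inner

/-! #### The outer chain -/

section Outer

variable [SFinite νΘ] {νD : Measure D} [SFinite νD]

/-- `d ↦ (d, θ)`, where the recorded response `a ∼ solve(d)` to `d` is obtained first, and then
`θ ∼ p_D(· ∣ d, a)` is drawn. -/
def attachOutcome (G : DefendAttackGame D A Θ νΘ) (solve : Kernel D A) : Kernel D (D × Θ) :=
  Kernel.id ×ₖ (G.outcomeD ∘ₖ (Kernel.id ×ₖ solve))

/-- Candidate of the outer chain: `d̃ ∼ g_D(· ∣ d)`, the response `a` to `d̃` is obtained from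
`solve`, and `θ̃ ∼ p_D(· ∣ d̃, a)`. -/
def outerCandidate (G : DefendAttackGame D A Θ νΘ) (gD : Proposal D νD) (solve : Kernel D A) :
    Kernel (D × Θ) (D × Θ) :=
  (G.attachOutcome solve ∘ₖ gD.kernel).comap Prod.fst measurable_fst

/-- Transition kernel of the outer chain, with the responses of the Attacker given by `solve`. -/
def outerKernel (G : DefendAttackGame D A Θ νΘ) (gD : Proposal D νD) (solve : Kernel D A) :
    Kernel (D × Θ) (D × Θ) :=
  mhKernel (fun z => G.uD z.1 z.2) G.measurable_uD (G.outerCandidate gD solve)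

instance (G : DefendAttackGame D A Θ νΘ) (gD : Proposal D νD) (solve : Kernel D A)
    [IsMarkovKernel solve] : IsMarkovKernel (G.outerKernel gD solve) := by
  unfold outerKernel outerCandidate attachOutcome; infer_instance

/-- Law of the trajectory `(d^(i), θ^(i))` of the outer chain, with `d^(0) = d₀`. -/
def outerLaw (G : DefendAttackGame D A Θ νΘ) (gD : Proposal D νD) (solve : Kernel D A)
    [IsMarkovKernel solve] (d₀ : D) : Measure (ℕ → D × Θ) :=
  chainLaw (G.attachOutcome solve d₀) (G.outerKernel gD solve)

end Outer

end DefendAttackGame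

end

/-!
A chain that draws the decision from a symmetric `g`, then its outcome from `p`, and accepts with
probability `min {1, u' / u}` is the Metropolis–Hastings chain of `π ∝ u p`: the factors `p` of the
target and of the candidates cancel in the acceptance ratio. Hence it is reversible with respect to
`π`, and it inherits the irreducibility of `g` because `u` and `p` are positive. Integrating out the
outcome turns `π` into a density proportional to the expected utility, whose mode is the optimal
decision.

Consistency of the estimators requires Harris recurrence, from every starting point. By
stationarity, the probability of avoiding a set `S` with `π S > 0` vanishes at `π`-almost every
state. A move which is not a rejection has a law dominated by `π`, so the avoidance probability
could be positive only at a state that the chain never leaves, which irreducibility excludes.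

The inner estimates thus converge almost surely to the constant `a*(d)`, so that the nested chain
is the outer chain with the table `a*` of responses.
-/

section Chains

variable {Z : Type*} [MeasurableSpace Z]

/-- The step of the chain with transition kernel `κ` from time `n` to time `n + 1`, as a kernel in
the whole past, which is the form in which Mathlib's Ionescu-Tulcea theorem takes it. -/
noncomputable def pastKernel (κ : Kernel Z Z) (n : ℕ) : Kernel (Finset.Iic n → Z) Z :=
  κ.comap (fun x => x ⟨n, Finset.mem_Iic.2 le_rfl⟩) (measurable_pi_apply _)

instance (κ : Kernel Z Z) [IsMarkovKernel κ] (n : ℕ) : IsMarkovKernel (pastKernel κ n) := by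
  unfold pastKernel; infer_instance

/-- The law of the path of the Markov chain with transition kernel `κ`, as a kernel in the initial
state. -/
noncomputable def pathKernel (κ : Kernel Z Z) [IsMarkovKernel κ] : Kernel Z (ℕ → Z) :=
  (Kernel.traj (X := fun _ => Z) (pastKernel κ) 0).comap
    (MeasurableEquiv.piUnique fun _ : Finset.Iic 0 => Z).symm (MeasurableEquiv.measurable _)

instance (κ : Kernel Z Z) [IsMarkovKernel κ] : IsMarkovKernel (pathKernel κ) := by
  unfold pathKernel; infer_instance

/-- The law `P` on paths has the Markov property with transition kernel `κ`: given the states up to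
time `n`, the state at time `n + 1` is drawn from `κ` at the state at time `n`. -/
def HasMarkovProperty (κ : Kernel Z Z) (P : Measure (ℕ → Z)) : Prop :=
  ∀ n, P.map (Preorder.frestrictLe n) ⊗ₘ pastKernel κ n =
    P.map fun x => (Preorder.frestrictLe n x, x (n + 1))

lemma measure_ext_of_map_frestrictLe {P Q : Measure (ℕ → Z)} [IsFiniteMeasure P]
    (h : ∀ n, P.map (Preorder.frestrictLe n) = Q.map (Preorder.frestrictLe n)) : P = Q := by
  have hP : IsProjectiveMeasureFamily (α := fun _ : ℕ => Z)
      fun I : Finset ℕ => P.map I.restrict := fun I J hJI =>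
    (Measure.map_map (Finset.measurable_restrict₂ hJI) (Finset.measurable_restrict I)).symm
  exact IsProjectiveLimit.unique (fun _ => rfl)
    ((isProjectiveLimit_nat_iff (X := fun _ => Z) hP Q).2 fun n => (h n).symm)

lemma map_frestrictLe_zero_eq {P Q : Measure (ℕ → Z)}
    (h : P.map (fun x => x 0) = Q.map (fun x => x 0)) :
    P.map (Preorder.frestrictLe 0) = Q.map (Preorder.frestrictLe 0) := by
  have factor : Preorder.frestrictLe (π := fun _ => Z) 0 =
      (fun (z : Z) (_ : Finset.Iic 0) => z) ∘ fun x : ℕ → Z => x 0 := by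
    ext x ⟨i, hi⟩
    obtain rfl : i = 0 := by simpa using hi
    rfl
  rw [factor, ← Measure.map_map (by fun_prop) (by fun_prop), h,
    Measure.map_map (by fun_prop) (by fun_prop)]

lemma map_frestrictLe_succ_eq {P Q : Measure (ℕ → Z)} {n : ℕ}
    (h : P.map (fun x => (Preorder.frestrictLe n x, x (n + 1))) =
      Q.map fun x => (Preorder.frestrictLe n x, x (n + 1))) :
    P.map (Preorder.frestrictLe (n + 1)) = Q.map (Preorder.frestrictLe (n + 1)) := by
  let glue : (Finset.Iic n → Z) × Z → (Finset.Iic (n + 1) → Z) := fun p i =>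
    if hi : i.1 ≤ n then p.1 ⟨i.1, Finset.mem_Iic.2 hi⟩ else p.2
  have glue_measurable : Measurable glue := by
    refine measurable_pi_lambda _ fun i => ?_
    by_cases hi : i.1 ≤ n
    · simp only [glue, hi, dite_true]; fun_prop
    · simp only [glue, hi, dite_false]; fun_prop
  have factor : Preorder.frestrictLe (π := fun _ => Z) (n + 1) =
      glue ∘ fun x : ℕ → Z => (Preorder.frestrictLe n x, x (n + 1)) := by
    ext x ⟨i, hi⟩
    rw [Finset.mem_Iic] at hi
    by_cases hin : i ≤ n
    · simp [glue, hin]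
    · obtain rfl : i = n + 1 := by omega
      simp [glue]
  rw [factor, ← Measure.map_map glue_measurable (by fun_prop), h,
    Measure.map_map glue_measurable (by fun_prop)]

namespace HasMarkovProperty

variable {κ : Kernel Z Z} {P Q : Measure (ℕ → Z)}

lemma ext [IsFiniteMeasure P] (hP : HasMarkovProperty κ P) (hQ : HasMarkovProperty κ Q)
    (h0 : P.map (fun x => x 0) = Q.map (fun x => x 0)) : P = Q := by
  refine measure_ext_of_map_frestrictLe fun n => ?_
  induction n with
  | zero => exact map_frestrictLe_zero_eq h0
  | succ n ih => exact map_frestrictLe_succ_eq (by rw [← hP, ← hQ, ih])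

lemma map_eval_succ [IsMarkovKernel κ] [SFinite P] (hP : HasMarkovProperty κ P) (n : ℕ) :
    P.map (fun x => x (n + 1)) = κ ∘ₘ P.map fun x => x n := by
  have hsnd := congrArg Measure.snd (hP n)
  rw [Measure.snd_compProd, Measure.snd_map_prodMk (by fun_prop), pastKernel,
    ← Kernel.comp_deterministic_eq_comap, ← Measure.comp_assoc,
    Measure.deterministic_comp_eq_map, Measure.map_map (by fun_prop) (by fun_prop)] at hsnd
  exact hsnd.symm

lemma lintegral_succ [IsMarkovKernel κ] [SFinite P] (hP : HasMarkovProperty κ P) (n : ℕ)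
    {F : (Finset.Iic n → Z) × Z → ENNReal} (hF : Measurable F) :
    ∫⁻ x, F (Preorder.frestrictLe n x, x (n + 1)) ∂P =
      ∫⁻ x, ∫⁻ y, F (Preorder.frestrictLe n x, y) ∂κ (x n) ∂P := by
  rw [← lintegral_map (g := fun x : ℕ → Z => (Preorder.frestrictLe n x, x (n + 1))) hF
    (by fun_prop), ← hP n, Measure.lintegral_compProd hF,
    lintegral_map hF.lintegral_kernel_prod_right' (by fun_prop)]
  rfl

lemma map_shift [IsMarkovKernel κ] [SFinite P] (hP : HasMarkovProperty κ P) :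
    HasMarkovProperty κ (P.map fun x n => x (n + 1)) := by
  intro n
  refine Measure.ext_of_lintegral _ fun F hF => ?_
  let tail : (Finset.Iic (n + 1) → Z) → (Finset.Iic n → Z) := fun y i =>
    y ⟨i.1 + 1, Finset.mem_Iic.2 (Nat.succ_le_succ (Finset.mem_Iic.1 i.2))⟩
  have hstep := hP.lintegral_succ (n + 1) (F := fun p => F (tail p.1, p.2)) (by fun_prop)
  rw [Measure.map_map (by fun_prop) (by fun_prop), Measure.map_map (by fun_prop) (by fun_prop),
    Measure.lintegral_compProd hF,
    lintegral_map (hF.lintegral_kernel_prod_right' (κ := pastKernel κ n)) (by fun_prop),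
    lintegral_map hF (by fun_prop)]
  exact hstep.symm

end HasMarkovProperty

section ChainLaw

variable (init : Measure Z) (κ : Kernel Z Z) [IsMarkovKernel κ]

lemma chainLaw_eq_comp_pathKernel : chainLaw init κ = pathKernel κ ∘ₘ init := by
  rw [pathKernel, ← Kernel.comp_deterministic_eq_comap, ← Measure.comp_assoc,
    Measure.deterministic_comp_eq_map]
  rfl

lemma chainLaw_dirac (z : Z) : chainLaw (Measure.dirac z) κ = pathKernel κ z := by
  rw [chainLaw_eq_comp_pathKernel, Measure.dirac_bind (Kernel.measurable _)]

instance [IsProbabilityMeasure init] : IsProbabilityMeasure (chainLaw init κ) := by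
  rw [chainLaw_eq_comp_pathKernel]; infer_instance

lemma hasMarkovProperty_chainLaw [IsProbabilityMeasure init] :
    HasMarkovProperty κ (chainLaw init κ) := fun _ =>
  Kernel.map_frestrictLe_trajMeasure_compProd_eq_map_trajMeasure (X := fun _ => Z)
    (κ := pastKernel κ)

lemma pathKernel_map_eval_zero : (pathKernel κ).map (fun x => x 0) = Kernel.id := by
  ext1 z
  have hstart := Kernel.traj_map_frestrictLe_apply (X := fun _ => Z) (κ := pastKernel κ) (a := 0)
    0 ((MeasurableEquiv.piUnique fun _ : Finset.Iic 0 => Z).symm z)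
  rw [Kernel.partialTraj_self, Kernel.id_apply] at hstart
  have heval := congrArg (Measure.map fun y : Finset.Iic 0 → Z => y ⟨0, by simp⟩) hstart
  rw [Measure.map_map (by fun_prop) (by fun_prop), Measure.map_dirac' (by fun_prop)] at heval
  rw [Kernel.map_apply _ (by fun_prop)]
  exact heval

lemma chainLaw_map_eval_zero : (chainLaw init κ).map (fun x => x 0) = init := by
  rw [chainLaw_eq_comp_pathKernel, Measure.map_comp _ _ (by fun_prop), pathKernel_map_eval_zero,
    Measure.id_comp]

lemma chainLaw_map_shift [IsProbabilityMeasure init] :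
    (chainLaw init κ).map (fun x n => x (n + 1)) = chainLaw (κ ∘ₘ init) κ := by
  have : IsProbabilityMeasure ((chainLaw init κ).map fun x n => x (n + 1)) :=
    Measure.isProbabilityMeasure_map (Measurable.aemeasurable (by fun_prop))
  refine (hasMarkovProperty_chainLaw init κ).map_shift.ext (hasMarkovProperty_chainLaw _ κ) ?_
  rw [chainLaw_map_eval_zero, Measure.map_map (by fun_prop) (by fun_prop)]
  exact ((hasMarkovProperty_chainLaw init κ).map_eval_succ 0).trans
    (by rw [chainLaw_map_eval_zero])

instance isMarkovKernel_pow (n : ℕ) : IsMarkovKernel (κ ^ n) := by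
  induction n with
  | zero => exact inferInstanceAs (IsMarkovKernel Kernel.id)
  | succ n ih => rw [pow_succ]; exact inferInstanceAs (IsMarkovKernel (_ ∘ₖ _))

lemma chainLaw_map_shift_iterate [IsProbabilityMeasure init] (k : ℕ) :
    (chainLaw init κ).map (fun x n => x (k + n)) = chainLaw ((κ ^ k) ∘ₘ init) κ := by
  induction k with
  | zero =>
    have hinit : (κ ^ 0 : Kernel Z Z) ∘ₘ init = init := Measure.id_comp
    simp only [hinit, zero_add, Measure.map_id']
  | succ k ih =>
    have hshift : (fun (x : ℕ → Z) n => x (k + 1 + n)) =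
        (fun x n => x (n + 1)) ∘ fun x n => x (k + n) := by
      ext x n; exact congrArg x (by omega)
    rw [hshift, ← Measure.map_map (by fun_prop) (by fun_prop), ih, chainLaw_map_shift, pow_succ',
      Measure.comp_assoc]
    rfl

lemma ae_chainLaw_of_forall_dirac {p : (ℕ → Z) → Prop} (hp : MeasurableSet {x | p x})
    (h : ∀ z, ∀ᵐ x ∂chainLaw (Measure.dirac z) κ, p x) : ∀ᵐ x ∂chainLaw init κ, p x := by
  simp only [chainLaw_dirac] at h
  rw [chainLaw_eq_comp_pathKernel, Measure.ae_comp_iff hp]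
  exact ae_of_all _ h

lemma ae_chainLaw_shift_of_forall_dirac [IsProbabilityMeasure init] (k : ℕ)
    {p : (ℕ → Z) → Prop} (hp : MeasurableSet {x | p x})
    (h : ∀ z, ∀ᵐ x ∂chainLaw (Measure.dirac z) κ, p x) :
    ∀ᵐ x ∂chainLaw init κ, p fun n => x (k + n) := by
  refine ae_of_ae_map (f := fun (x : ℕ → Z) n => x (k + n))
    (Measurable.aemeasurable (by fun_prop)) ?_
  rw [chainLaw_map_shift_iterate]
  exact ae_chainLaw_of_forall_dirac _ κ hp h

end ChainLaw

end Chains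

section Recurrence

variable {Z : Type*} [MeasurableSpace Z] {κ : Kernel Z Z} {π : Measure Z}

lemma ae_lintegral_kernel_eq_of_le (hπ : κ.Invariant π) {f : Z → ENNReal} (hf : Measurable f)
    (hfin : ∫⁻ z, f z ∂π ≠ ⊤) (hle : ∀ᵐ z ∂π, f z ≤ ∫⁻ y, f y ∂κ z) :
    ∀ᵐ z ∂π, f z = ∫⁻ y, f y ∂κ z := by
  refine ae_eq_of_ae_le_of_lintegral_le hle hfin hf.lintegral_kernel.aemeasurable ?_
  rw [← Measure.lintegral_bind κ.aemeasurable hf.aemeasurable, hπ.def]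

lemma ae_eq_zero_of_absorbing [IsMarkovKernel κ] [IsFiniteMeasure π] (hπ : κ.Invariant π)
    {N : Set Z} (hN : MeasurableSet N) (habs : ∀ᵐ z ∂π, z ∈ N → κ z Nᶜ = 0) :
    ∀ᵐ z ∂π, z ∉ N → κ z N = 0 := by
  have hle : ∀ᵐ z ∂π, N.indicator 1 z ≤ ∫⁻ y, N.indicator 1 y ∂κ z := by
    filter_upwards [habs] with z hz
    rw [lintegral_indicator_one hN]
    by_cases hzN : z ∈ N
    · simp [hzN, (prob_compl_eq_zero_iff hN).1 (hz hzN)]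
    · simp [hzN]
  filter_upwards [ae_lintegral_kernel_eq_of_le hπ (measurable_one.indicator hN)
    (by simp [lintegral_indicator_one hN]) hle] with z hz hzN
  rw [← lintegral_indicator_one hN, ← hz, Set.indicator_of_notMem hzN]

lemma ae_pow_eq_zero_of_invariant [IsMarkovKernel κ] [SFinite π] (hπ : κ.Invariant π) {N : Set Z}
    (hN : MeasurableSet N) (hout : ∀ᵐ z ∂π, z ∉ N → κ z N = 0) (n : ℕ) :
    ∀ᵐ z ∂π, z ∉ N → (κ ^ n) z N = 0 := by
  induction n with
  | zero =>
    refine ae_of_all _ fun z hz => ?_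
    change Measure.dirac z N = 0
    rw [Measure.dirac_apply' z hN, Set.indicator_of_notMem hz]
  | succ n ih =>
    have hnext : ∀ᵐ z ∂π, ∀ᵐ y ∂κ z, y ∉ N → (κ ^ n) y N = 0 :=
      Measure.ae_ae_of_ae_comp (by rwa [hπ.def])
    filter_upwards [hout, hnext] with z hz hzn hzN
    rw [add_comm, Kernel.pow_add_apply_eq_lintegral _ _ _ _ hN, pow_one,
      lintegral_eq_zero_iff (Kernel.measurable_coe _ hN)]
    filter_upwards [hzn, measure_eq_zero_iff_ae_notMem.1 (hz hzN)] with y hy hyN using hy hyN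

lemma eq_dirac_of_lintegral_eq {μ ρ : Measure Z} [IsProbabilityMeasure μ] {c : ENNReal} {z : Z}
    (hμ : μ = ρ + c • Measure.dirac z) {f : Z → ENNReal} (hf : Measurable f)
    (hρ : ∀ᵐ y ∂ρ, f y = 0) (hne : f z ≠ 0) (hfin : f z ≠ ⊤) (heq : ∫⁻ y, f y ∂μ = f z) :
    μ = Measure.dirac z := by
  have hc : c = 1 := by
    rw [hμ, lintegral_add_measure, lintegral_smul_measure, lintegral_dirac' _ hf,
      lintegral_congr_ae hρ, lintegral_zero, zero_add, smul_eq_mul] at heq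
    exact (ENNReal.mul_left_inj hne hfin).1 (heq.trans (one_mul _).symm)
  subst hc
  have hmass : ρ Set.univ + 1 = 1 := by
    have huniv : μ Set.univ = 1 := measure_univ
    simpa [hμ] using huniv
  have hρ0 : ρ = 0 := Measure.measure_univ_eq_zero.1
    ((ENNReal.add_left_inj ENNReal.one_ne_top).1 (hmass.trans (zero_add 1).symm))
  rw [hμ, hρ0, zero_add, one_smul]

lemma pow_apply_eq_dirac {z : Z} (hz : κ z = Measure.dirac z) (n : ℕ) :
    (κ ^ n) z = Measure.dirac z := by
  induction n with
  | zero => rfl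
  | succ n ih =>
    rw [Kernel.pow_add, pow_one, Kernel.comp_apply, hz, Measure.dirac_bind (Kernel.measurable _),
      ih]

variable [IsMarkovKernel κ] {S : Set Z}

/-- The probability that the chain with transition kernel `κ` never visits `S`, as a function of the
initial state; visits at time `0` count. -/
noncomputable def avoidProb (κ : Kernel Z Z) [IsMarkovKernel κ] (S : Set Z) (z : Z) : ENNReal :=
  pathKernel κ z {x | ∀ n, x n ∉ S}

lemma measurableSet_forall_notMem (hS : MeasurableSet S) :
    MeasurableSet {x : ℕ → Z | ∀ n, x n ∉ S} := by
  simp only [Set.ofPred_forall]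
  exact MeasurableSet.iInter fun n => (hS.preimage (measurable_pi_apply n)).compl

lemma measurable_avoidProb (hS : MeasurableSet S) : Measurable (avoidProb κ S) :=
  Kernel.measurable_coe _ (measurableSet_forall_notMem hS)

lemma avoidProb_ne_top (z : Z) : avoidProb κ S z ≠ ⊤ := measure_ne_top _ _

lemma pathKernel_forall_succ_notMem (hS : MeasurableSet S) (z : Z) :
    pathKernel κ z {x | ∀ n, x (n + 1) ∉ S} = ∫⁻ y, avoidProb κ S y ∂κ z := by
  have hshift := chainLaw_map_shift (Measure.dirac z) κ
  rw [Measure.dirac_bind κ.measurable, chainLaw_dirac, chainLaw_eq_comp_pathKernel] at hshift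
  simp only [avoidProb]
  rw [← Measure.bind_apply (measurableSet_forall_notMem hS) (Kernel.aemeasurable _), ← hshift,
    Measure.map_apply (by fun_prop) (measurableSet_forall_notMem hS)]
  rfl

lemma ae_pathKernel_zero_mem (hS : MeasurableSet S) {z : Z} (hz : z ∈ S) :
    ∀ᵐ x ∂pathKernel κ z, x 0 ∈ S := by
  refine ae_of_ae_map (f := fun x : ℕ → Z => x 0) (p := (· ∈ S))
    (measurable_pi_apply 0).aemeasurable ?_
  rw [← Kernel.map_apply _ (by fun_prop), pathKernel_map_eval_zero, Kernel.id_apply]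
  exact (ae_dirac_iff hS).2 hz

lemma avoidProb_of_mem (hS : MeasurableSet S) {z : Z} (hz : z ∈ S) : avoidProb κ S z = 0 :=
  measure_mono_null (fun _ hx => hx 0) (ae_iff.1 (ae_pathKernel_zero_mem (κ := κ) hS hz))

lemma avoidProb_of_notMem (hS : MeasurableSet S) {z : Z} (hz : z ∉ S) :
    avoidProb κ S z = ∫⁻ y, avoidProb κ S y ∂κ z := by
  rw [← pathKernel_forall_succ_notMem hS, avoidProb]
  refine measure_congr ?_
  filter_upwards [ae_pathKernel_zero_mem (κ := κ) hS.compl hz] with x hx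
  exact propext ⟨fun h n => h (n + 1), fun h n => n.casesOn hx h⟩

lemma avoidProb_le_lintegral (hS : MeasurableSet S) (z : Z) :
    avoidProb κ S z ≤ ∫⁻ y, avoidProb κ S y ∂κ z := by
  by_cases hz : z ∈ S
  · simp [avoidProb_of_mem hS hz]
  · exact (avoidProb_of_notMem hS hz).le

-- The zero set `N` of the avoidance probability is absorbing, so by stationarity it is not entered
-- from outside; since `S ⊆ N` is reached from everywhere, almost no state lies outside `N`.
lemma avoidProb_ae_eq_zero [IsFiniteMeasure π] (hπ : κ.Invariant π) (hS : MeasurableSet S)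
    (hreach : ∀ z, ∃ n, 0 < (κ ^ n) z S) : ∀ᵐ z ∂π, avoidProb κ S z = 0 := by
  let N : Set Z := {z | avoidProb κ S z = 0}
  have hm : Measurable (avoidProb κ S) := measurable_avoidProb hS
  have hN : MeasurableSet N := hm (measurableSet_singleton 0)
  have hfin : ∫⁻ z, avoidProb κ S z ∂π ≠ ⊤ :=
    ((lintegral_mono fun _ => prob_le_one).trans_lt (by simp : ∫⁻ _, 1 ∂π < ⊤)).ne
  have habs : ∀ᵐ z ∂π, z ∈ N → κ z Nᶜ = 0 := by
    filter_upwards [ae_lintegral_kernel_eq_of_le hπ hm hfin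
      (ae_of_all _ (avoidProb_le_lintegral hS))] with z hz hzN
    exact ae_iff.1 ((lintegral_eq_zero_iff hm).1 (hz.symm.trans hzN))
  filter_upwards [ae_all_iff.2
    (ae_pow_eq_zero_of_invariant hπ hN (ae_eq_zero_of_absorbing hπ hN habs))] with z hz
  by_contra hzN
  obtain ⟨n, hn⟩ := hreach z
  exact hn.ne' (measure_mono_null (fun _ hy => avoidProb_of_mem hS hy) (hz n hzN))

lemma avoidProb_eq_zero [IsFiniteMeasure π] (hπ : κ.Invariant π) (hS : MeasurableSet S)
    (hreach : ∀ z, ∃ n, 0 < (κ ^ n) z S) {z : Z} {ρ : Measure Z} {c : ENNReal} (hρ : ρ ≪ π)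
    (hκ : κ z = ρ + c • Measure.dirac z) : avoidProb κ S z = 0 := by
  by_contra hz
  have hzS : z ∉ S := fun h => hz (avoidProb_of_mem hS h)
  have habs : κ z = Measure.dirac z := eq_dirac_of_lintegral_eq hκ (measurable_avoidProb hS)
    (hρ.ae_le (avoidProb_ae_eq_zero hπ hS hreach)) hz (avoidProb_ne_top z)
    (avoidProb_of_notMem hS hzS).symm
  obtain ⟨n, hn⟩ := hreach z
  rw [pow_apply_eq_dirac habs, Measure.dirac_apply' _ hS, Set.indicator_of_notMem hzS] at hn
  exact hn.false

theorem harrisRecurrent_of_isIrreducible [IsFiniteMeasure π] (hπ : κ.Invariant π)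
    (hirr : κ.IsIrreducible π)
    (hmove : ∀ z, ∃ (ρ : Measure Z) (c : ENNReal), ρ ≪ π ∧ κ z = ρ + c • Measure.dirac z) :
    HarrisRecurrent κ π := by
  intro S hS hpos z
  have hzero : ∀ y, avoidProb κ S y = 0 := fun y => by
    obtain ⟨ρ, c, hρ, hκ⟩ := hmove y
    exact avoidProb_eq_zero hπ hS (hirr.irreducible hS hpos) hρ hκ
  have hnever := pathKernel_forall_succ_notMem (κ := κ) hS z
  simp only [hzero, lintegral_zero] at hnever
  rw [chainLaw_dirac, ae_iff]
  simpa only [not_exists] using hnever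

end Recurrence

section Irreducibility

variable {Z : Type*} [MeasurableSpace Z] {Q K : Kernel Z Z} {φ ψ : Measure Z}

lemma pow_apply_absolutelyContinuous (h : ∀ z, Q z ≪ K z) (n : ℕ) (z : Z) :
    (Q ^ n) z ≪ (K ^ n) z := by
  induction n with
  | zero => exact Measure.AbsolutelyContinuous.rfl
  | succ n ih =>
    rw [add_comm, Kernel.pow_add, Kernel.pow_add, Kernel.comp_apply, Kernel.comp_apply, pow_one,
      pow_one]
    exact ih.comp (ae_of_all _ h)

lemma isIrreducible_of_absolutelyContinuous (hirr : Q.IsIrreducible φ) (h : ∀ z, Q z ≪ K z)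
    (hψ : ψ ≪ φ) : K.IsIrreducible ψ := by
  refine ⟨fun S hS hpos z => ?_⟩
  obtain ⟨n, hn⟩ := hirr.irreducible hS (pos_iff_ne_zero.2 fun h0 => hpos.ne' (hψ h0)) z
  exact ⟨n, pos_iff_ne_zero.2 fun h0 => hn.ne' (pow_apply_absolutelyContinuous h n z h0)⟩

lemma exists_pow_succ_pos [IsMarkovKernel Q] (hirr : Q.IsIrreducible φ) {S : Set Z}
    (hS : MeasurableSet S) (hpos : 0 < φ S) (z : Z) : ∃ n, 0 < (Q ^ (n + 1)) z S := by
  by_contra! hnever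
  have hnull : ∀ n, ∀ᵐ y ∂Q z, (Q ^ n) y S = 0 := fun n => by
    have hn := hnever n
    rwa [nonpos_iff_eq_zero, add_comm, Kernel.pow_add_apply_eq_lintegral _ _ _ _ hS, pow_one,
      lintegral_eq_zero_iff (Kernel.measurable_coe _ hS)] at hn
  obtain ⟨y, hy⟩ := (ae_all_iff.2 hnull).exists
  obtain ⟨n, hn⟩ := hirr.irreducible hS hpos y
  exact hn.ne' (hy n)

end Irreducibility

section MetropolisHastings

variable {Z : Type*}

/-- The acceptance probability `min {1, u(y) / u(z)}` of the candidate `y` in the state `z`. -/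
noncomputable def acceptProb (u : Z → ℝ) (z y : Z) : ENNReal :=
  ENNReal.ofReal (min 1 (u y / u z))

lemma acceptProb_pos {u : Z → ℝ} (hpos : ∀ z, 0 < u z) (z y : Z) : 0 < acceptProb u z y :=
  ENNReal.ofReal_pos.2 (lt_min one_pos (div_pos (hpos y) (hpos z)))

lemma ofReal_mul_acceptProb {u : Z → ℝ} (hpos : ∀ z, 0 < u z) (z y : Z) :
    ENNReal.ofReal (u z) * acceptProb u z y = ENNReal.ofReal (min (u z) (u y)) := by
  rw [acceptProb, ← ENNReal.ofReal_mul (hpos z).le, mul_min_of_nonneg _ _ (hpos z).le, mul_one,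
    mul_div_cancel₀ _ (hpos z).ne']

variable [MeasurableSpace Z] {μ₀ : Measure Z} {κ : Kernel Z Z} {k : Z → Z → ENNReal}
  {c w : Z → ENNReal}

lemma setLIntegral_kernel_withDensity_eq [SFinite μ₀] (hk : Measurable (Function.uncurry k))
    (hκ : ∀ z, κ z = μ₀.withDensity (k z) + c z • Measure.dirac z) (hw : Measurable w)
    {A B : Set Z} (hA : MeasurableSet A) (hB : MeasurableSet B) :
    ∫⁻ z in A, κ z B ∂μ₀.withDensity w =
      ∫⁻ z in A, ∫⁻ y in B, w z * k z y ∂μ₀ ∂μ₀ + ∫⁻ z in B ∩ A, w z * c z ∂μ₀ := by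
  have hflow : Measurable fun z => ∫⁻ y in B, w z * k z y ∂μ₀ :=
    ((hw.comp measurable_fst).mul hk).lintegral_prod_right'
  have hκB : ∀ z, w z * κ z B =
      ∫⁻ y in B, w z * k z y ∂μ₀ + B.indicator (fun z => w z * c z) z := fun z => by
    rw [hκ, Measure.add_apply, Measure.smul_apply, withDensity_apply _ hB,
      Measure.dirac_apply' _ hB, mul_add, lintegral_const_mul _ hk.of_uncurry_left]
    by_cases hz : z ∈ B <;> simp [hz]
  rw [setLIntegral_withDensity_eq_setLIntegral_mul _ hw (Kernel.measurable_coe _ hB) hA]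
  simp only [Pi.mul_apply, hκB]
  rw [lintegral_add_left hflow, setLIntegral_indicator hB]

lemma isReversible_of_detailedBalance [SFinite μ₀] (hk : Measurable (Function.uncurry k))
    (hκ : ∀ z, κ z = μ₀.withDensity (k z) + c z • Measure.dirac z) (hw : Measurable w)
    (hbalance : ∀ z y, w z * k z y = w y * k y z) : κ.IsReversible (μ₀.withDensity w) := by
  intro A B hA hB
  rw [setLIntegral_kernel_withDensity_eq hk hκ hw hA hB,
    setLIntegral_kernel_withDensity_eq hk hκ hw hB hA, Set.inter_comm,
    lintegral_lintegral_swap ((hw.comp measurable_fst).mul hk).aemeasurable]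
  simp only [hbalance]

variable {u : Z → ℝ} (hu : Measurable u)
include hu

lemma measurable_acceptProb : Measurable (Function.uncurry (acceptProb u)) := by
  unfold Function.uncurry acceptProb; fun_prop

lemma mhKernel_apply (Q : Kernel Z Z) [IsMarkovKernel Q] (z : Z) :
    mhKernel u hu Q z = (Q z).withDensity (acceptProb u z) +
      (∫⁻ y, (1 - acceptProb u z y) ∂Q z) • Measure.dirac z := by
  have hα : Measurable (acceptProb u z) := (measurable_acceptProb hu).of_uncurry_left
  have hβ : Measurable fun y => 1 - acceptProb u z y := measurable_const.sub hα
  have hstep : ∀ (S : Set Z), MeasurableSet S → ∀ y, acceptReject u hu (z, y) S =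
      S.indicator (acceptProb u z) y + (1 - acceptProb u z y) * Measure.dirac z S := by
    intro S hS y
    change (acceptProb u z y • Measure.dirac y + (1 - acceptProb u z y) • Measure.dirac z) S = _
    by_cases hy : y ∈ S <;> simp [Measure.dirac_apply' _ hS, hy]
  ext S hS
  rw [mhKernel, Kernel.comp_apply' _ _ _ hS, Kernel.prod_apply, Kernel.id_apply,
    Measure.dirac_prod, lintegral_map (Kernel.measurable_coe _ hS) measurable_prodMk_left]
  simp only [hstep S hS]
  rw [lintegral_add_left (hα.indicator hS), lintegral_indicator hS,
    lintegral_mul_const _ hβ, Measure.add_apply, Measure.smul_apply,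
    smul_eq_mul, withDensity_apply _ hS]

variable (hpos : ∀ z, 0 < u z) {Q : Kernel Z Z} [IsMarkovKernel Q] {π : Measure Z}
include hpos

lemma absolutelyContinuous_mhKernel (z : Z) : Q z ≪ mhKernel u hu Q z := by
  have hα : Measurable (acceptProb u z) := (measurable_acceptProb hu).of_uncurry_left
  rw [mhKernel_apply]
  exact (withDensity_absolutelyContinuous' hα.aemeasurable
    (ae_of_all _ fun y => (acceptProb_pos hpos z y).ne')).trans
    (Measure.absolutelyContinuous_of_le (Measure.le_add_right le_rfl))

lemma isReversible_mhKernel [SFinite μ₀] {q h : Z → Z → ENNReal}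
    (hq : Measurable (Function.uncurry q)) (hQ : ∀ z, Q z = μ₀.withDensity (q z))
    (hw : Measurable w) (hwq : ∀ z y, w z * q z y = ENNReal.ofReal (u z) * h z y)
    (hsymm : ∀ z y, h z y = h y z) : (mhKernel u hu Q).IsReversible (μ₀.withDensity w) := by
  have hα := measurable_acceptProb hu
  refine isReversible_of_detailedBalance (k := fun z y => q z y * acceptProb u z y)
    (c := fun z => ∫⁻ y, (1 - acceptProb u z y) ∂Q z) (hq.mul hα) (fun z => ?_) hw fun z y => ?_
  · rw [mhKernel_apply, hQ, ← withDensity_mul _ hq.of_uncurry_left hα.of_uncurry_left]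
    rfl
  · have hflow : ∀ z y, w z * (q z y * acceptProb u z y) =
        ENNReal.ofReal (min (u z) (u y)) * h z y := fun z y => by
      rw [← ofReal_mul_acceptProb hpos, ← mul_assoc, hwq, mul_right_comm]
    exact (hflow z y).trans (by rw [min_comm, hsymm, hflow y z])

lemma harrisRecurrent_mhKernel [IsFiniteMeasure π] (hπ : (mhKernel u hu Q).Invariant π)
    (hirr : Q.IsIrreducible π) (hQ : ∀ z, Q z ≪ π) : HarrisRecurrent (mhKernel u hu Q) π :=
  harrisRecurrent_of_isIrreducible hπ
    (isIrreducible_of_absolutelyContinuous hirr (absolutelyContinuous_mhKernel hu hpos)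
      Measure.AbsolutelyContinuous.rfl)
    fun z => ⟨_, _, (withDensity_absolutelyContinuous _ _).trans (hQ z), mhKernel_apply hu Q z⟩

end MetropolisHastings

section Candidates

variable {X Θ : Type*} [MeasurableSpace X] [MeasurableSpace Θ]

/-- From the state `(x, θ)`, a new decision is drawn from `g x`, and then an outcome from `o` at the
new decision. -/
noncomputable def candidateKernel (g : Kernel X X) (o : Kernel X Θ) : Kernel (X × Θ) (X × Θ) :=
  ((Kernel.id ×ₖ o) ∘ₖ g).comap Prod.fst measurable_fst

variable {g : Kernel X X} [IsMarkovKernel g] {o : Kernel X Θ} [IsMarkovKernel o]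

instance : IsMarkovKernel (candidateKernel g o) := by
  unfold candidateKernel; infer_instance

lemma candidateKernel_comp (μ : Measure (X × Θ)) [SFinite μ] :
    candidateKernel g o ∘ₘ μ = (g ∘ₘ μ.fst) ⊗ₘ o := by
  rw [candidateKernel, ← Kernel.comp_deterministic_eq_comap, ← Measure.comp_assoc,
    ← Measure.comp_assoc, Measure.deterministic_comp_eq_map, Measure.compProd_eq_comp_prod]
  rfl

lemma candidateKernel_apply (z : X × Θ) : candidateKernel g o z = (g z.1) ⊗ₘ o := by
  have h := candidateKernel_comp (g := g) (o := o) (Measure.dirac z)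
  rwa [Measure.dirac_bind (Kernel.measurable _), Measure.fst, Measure.map_dirac' measurable_fst,
    Measure.dirac_bind (Kernel.measurable _)] at h

lemma candidateKernel_pow_succ_apply (n : ℕ) (z : X × Θ) :
    (candidateKernel g o ^ (n + 1)) z = ((g ^ (n + 1)) z.1) ⊗ₘ o := by
  induction n with
  | zero => simpa using candidateKernel_apply z
  | succ n ih =>
    rw [add_comm, Kernel.pow_add _ 1, Kernel.pow_add _ 1, Kernel.comp_apply, Kernel.comp_apply,
      pow_one, pow_one, ih, candidateKernel_comp, Measure.fst_compProd]

lemma compProd_pos_iff {μ : Measure X} [SFinite μ] {S : Set (X × Θ)} (hS : MeasurableSet S) :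
    0 < (μ ⊗ₘ o) S ↔ 0 < μ {x | o x (Prod.mk x ⁻¹' S) ≠ 0} := by
  rw [Measure.compProd_apply hS,
    lintegral_pos_iff_support (Kernel.measurable_kernel_prodMk_left hS)]
  rfl

variable {νX : Measure X} {νΘ : Measure Θ} [SFinite νX] [SFinite νΘ]

lemma isIrreducible_candidateKernel (hirr : g.IsIrreducible νX) (ho : ∀ x, νΘ ≪ o x) :
    (candidateKernel g o).IsIrreducible (νX.prod νΘ) := by
  refine ⟨fun S hS hpos z => ?_⟩
  have hac : νX.prod νΘ ≪ νX ⊗ₘ o := by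
    rw [← Measure.compProd_const]
    exact Measure.AbsolutelyContinuous.compProd_right (ae_of_all _ ho)
  have hposX := (compProd_pos_iff hS).1 (pos_iff_ne_zero.2 fun h0 => hpos.ne' (hac h0))
  obtain ⟨n, hn⟩ := exists_pow_succ_pos hirr
    (Kernel.measurable_kernel_prodMk_left hS (measurableSet_singleton 0).compl) hposX z.1
  exact ⟨n + 1, by rwa [candidateKernel_pow_succ_apply, gt_iff_lt, compProd_pos_iff hS]⟩

lemma Proposal.kernel_apply (G : Proposal X νX) (x : X) :
    G.kernel x = νX.withDensity fun y => ENNReal.ofReal (G.g y x) := by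
  have hg : Measurable (Function.uncurry fun x y => ENNReal.ofReal (G.g y x)) :=
    (G.measurable.comp measurable_swap).ennreal_ofReal
  rw [Proposal.kernel, Kernel.withDensity_apply _ hg, Kernel.const_apply]

lemma candidateKernel_proposal_apply (G : Proposal X νX) {q : X → Θ → ENNReal}
    (hq : Measurable (Function.uncurry q)) (ho : ∀ x, o x = νΘ.withDensity (q x)) (z : X × Θ) :
    candidateKernel G.kernel o z =
      (νX.prod νΘ).withDensity fun y => ENNReal.ofReal (G.g y.1 z.1) * q y.1 y.2 := by
  have hg : Measurable fun x => ENNReal.ofReal (G.g x z.1) :=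
    (G.measurable.comp measurable_prodMk_right).ennreal_ofReal
  have ho' : o = (Kernel.const X νΘ).withDensity q := by
    ext1 x
    rw [ho, Kernel.withDensity_apply _ hq, Kernel.const_apply]
  have : IsSFiniteKernel ((Kernel.const X νΘ).withDensity q) := by
    rw [← ho']; infer_instance
  rw [candidateKernel_apply, G.kernel_apply, ho', Measure.compProd_withDensity hq,
    Measure.compProd_const, prod_withDensity_left hg]
  exact (withDensity_mul _ (hg.comp measurable_fst) hq).symm

end Candidates

section Estimation

lemma modeEstimate_zero_shift {X Y : Type*} (T : (n : ℕ) → (Fin n → X) → X) (burn total : ℕ)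
    (x : ℕ → X × Y) :
    modeEstimate T 0 (total - burn) (fun n => x (burn + n)) = modeEstimate T burn total x := by
  simp only [modeEstimate, Nat.sub_zero, zero_add, add_assoc]

variable {X : Type*} [TopologicalSpace X] [MeasurableSpace X]

lemma DiscreteOrInterval.metrizableSpace (ν : Measure X) [h : DiscreteOrInterval X ν] :
    TopologicalSpace.MetrizableSpace X := by
  rcases h.discrete_or_interval with ⟨_, _, _⟩ | ⟨_, _, _, _, he, _⟩
  · infer_instance
  · exact he.metrizableSpace

lemma IsConsistentModeEstimator.ae_tendsto {Y : Type*} [MeasurableSpace Y]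
    [OpensMeasurableSpace X] [FirstCountableTopology X] {ν : Measure X}
    {T : (n : ℕ) → (Fin n → X) → X} {f : X → ℝ}
    (hT : IsConsistentModeEstimator ν Y T f) {m : X} (hm : IsMode f m)
    {κ : Kernel (X × Y) (X × Y)} [IsMarkovKernel κ] {π : Measure (X × Y)} [IsProbabilityMeasure π]
    (hπ : κ.Invariant π) (hharris : HarrisRecurrent κ π)
    (hfst : π.fst = ν.withDensity fun x => ENNReal.ofReal (f x))
    (init : Measure (X × Y)) [IsProbabilityMeasure init] (burn : ℕ) :
    ∀ᵐ x ∂chainLaw init κ, Tendsto (fun N => modeEstimate T burn N x) atTop (𝓝 m) := by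
  have hmeas : ∀ N, Measurable fun x : ℕ → X × Y => modeEstimate T 0 N x := fun N =>
    (hT.1 _).comp (by fun_prop)
  filter_upwards [ae_chainLaw_shift_of_forall_dirac init κ burn
    (measurableSet_tendsto (𝓝 m) hmeas) (hT.2 m hm κ π hπ hharris hfst)] with x hx
  simpa only [Function.comp_def, modeEstimate_zero_shift] using
    hx.comp (tendsto_sub_atTop_nat burn)

end Estimation

section DecisionProblem

variable {X Θ : Type*} [MeasurableSpace X] [MeasurableSpace Θ]

/-- A decision problem under uncertainty: the decision `x` has the outcome `θ` with density
`density x θ` with respect to `ν`, and then the utility `utility x θ`. Both agents of a sequential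
game face such a problem once the moves of the other one are fixed. -/
structure DecisionProblem (X Θ : Type*) [MeasurableSpace X] [MeasurableSpace Θ]
    (ν : Measure Θ) where
  utility : X → Θ → ℝ
  density : X → Θ → ℝ
  measurable_utility : Measurable fun z : X × Θ => utility z.1 z.2
  measurable_density : Measurable fun z : X × Θ => density z.1 z.2
  utility_pos : ∀ x θ, 0 < utility x θ
  density_pos : ∀ x θ, 0 < density x θ
  lintegral_density : ∀ x, ∫⁻ θ, ENNReal.ofReal (density x θ) ∂ν = 1

lemma Proposal.reference_ne_zero [Nonempty X] {ν : Measure X} (G : Proposal X ν) : ν ≠ 0 := by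
  rintro rfl
  simpa using G.lintegral_eq_one (Classical.arbitrary X)

lemma isProbabilityMeasure_withDensity {μ : Measure X} {f : X → ENNReal}
    (hf : ∫⁻ x, f x ∂μ = 1) : IsProbabilityMeasure (μ.withDensity f) :=
  ⟨by rw [withDensity_apply _ .univ, Measure.restrict_univ, hf]⟩

lemma fst_withDensity_prod {μ : Measure X} {ν : Measure Θ} [SFinite μ] [SFinite ν]
    {f : X × Θ → ENNReal} (hf : Measurable f) :
    ((μ.prod ν).withDensity f).fst = μ.withDensity fun x => ∫⁻ θ, f (x, θ) ∂ν := by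
  ext s hs
  rw [Measure.fst_apply hs, withDensity_apply _ (hs.preimage measurable_fst),
    withDensity_apply _ hs, ← Set.prod_univ, ← Measure.prod_restrict, Measure.restrict_univ,
    lintegral_prod _ hf.aemeasurable]

namespace DecisionProblem

lemma reference_ne_zero [Nonempty X] {ν : Measure Θ} (P : DecisionProblem X Θ ν) : ν ≠ 0 := by
  rintro rfl
  simpa using P.lintegral_density (Classical.arbitrary X)

variable {νX : Measure X} {νΘ : Measure Θ} (P : DecisionProblem X Θ νΘ)

/-- The expected utility of the decision `x`. -/
noncomputable def expectedUtility (x : X) : ℝ := ∫ θ, P.utility x θ * P.density x θ ∂νΘ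

/-- The unnormalized density `utility * density` of the augmented distribution. -/
def weight (z : X × Θ) : ℝ := P.utility z.1 z.2 * P.density z.1 z.2

/-- The density of the augmented distribution of (decision, outcome) pairs. -/
noncomputable def augDensity (νX : Measure X) (z : X × Θ) : ℝ :=
  P.weight z / ∫ w, P.weight w ∂(νX.prod νΘ)

/-- The augmented distribution on (decision, outcome) pairs, in which the utility reweights the
outcome probabilities. -/
noncomputable def aug (νX : Measure X) : Measure (X × Θ) :=
  (νX.prod νΘ).withDensity fun z => ENNReal.ofReal (P.augDensity νX z)

/-- The marginal density of the decision under the augmented distribution. -/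
noncomputable def margDensity (νX : Measure X) (x : X) : ℝ := ∫ θ, P.augDensity νX (x, θ) ∂νΘ

lemma weight_pos (z : X × Θ) : 0 < P.weight z := mul_pos (P.utility_pos _ _) (P.density_pos _ _)

lemma measurable_augDensity : Measurable (P.augDensity νX) :=
  (P.measurable_utility.mul P.measurable_density).div_const _

lemma augDensity_nonneg (z : X × Θ) : 0 ≤ P.augDensity νX z :=
  div_nonneg (P.weight_pos z).le (integral_nonneg fun w => (P.weight_pos w).le)

lemma ofReal_augDensity (z : X × Θ) :
    ENNReal.ofReal (P.augDensity νX z) = ENNReal.ofReal (P.utility z.1 z.2) *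
      (ENNReal.ofReal (P.density z.1 z.2) *
        ENNReal.ofReal (∫ w, P.weight w ∂(νX.prod νΘ))⁻¹) := by
  rw [← ENNReal.ofReal_mul (P.density_pos _ _).le, ← ENNReal.ofReal_mul (P.utility_pos _ _).le,
    ← mul_assoc, ← div_eq_mul_inv]
  rfl

lemma fst_aug [SFinite νX] [SFinite νΘ] (hslice : ∀ x, Integrable (fun θ => P.weight (x, θ)) νΘ) :
    (P.aug νX).fst = νX.withDensity fun x => ENNReal.ofReal (P.margDensity νX x) := by
  rw [aug, fst_withDensity_prod P.measurable_augDensity.ennreal_ofReal]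
  congr with x
  exact (ofReal_integral_eq_lintegral_ofReal ((hslice x).div_const _)
    (ae_of_all _ fun θ => P.augDensity_nonneg _)).symm

section Normalization

variable [SFinite νΘ] [NeZero νX] (hint : Integrable P.weight (νX.prod νΘ))
include hint

lemma integral_weight_pos : 0 < ∫ z, P.weight z ∂(νX.prod νΘ) := by
  have : Nonempty X := νX.nonempty_of_neZero
  have hsupp : Function.support P.weight = Set.univ :=
    Set.eq_univ_of_forall fun z => (P.weight_pos z).ne'
  rw [integral_pos_iff_support_of_nonneg (fun z => (P.weight_pos z).le) hint, hsupp,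
    ← Set.univ_prod_univ, Measure.prod_prod]
  exact ENNReal.mul_pos (NeZero.ne _) (Measure.measure_univ_ne_zero.2 P.reference_ne_zero)

lemma isProbabilityMeasure_aug : IsProbabilityMeasure (P.aug νX) := by
  refine isProbabilityMeasure_withDensity ?_
  rw [← ofReal_integral_eq_lintegral_ofReal (f := P.augDensity νX) (hint.div_const _)
    (ae_of_all _ P.augDensity_nonneg)]
  simp only [augDensity]
  rw [integral_div, div_self (P.integral_weight_pos hint).ne', ENNReal.ofReal_one]

lemma isMode_margDensity {m : X} (hm : IsMode P.expectedUtility m) :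
    IsMode (P.margDensity νX) m := by
  intro x hx
  simp only [margDensity, augDensity, integral_div]
  exact div_lt_div_of_pos_right (hm x hx) (P.integral_weight_pos hint)

lemma prod_absolutelyContinuous_aug : νX.prod νΘ ≪ P.aug νX :=
  withDensity_absolutelyContinuous' P.measurable_augDensity.ennreal_ofReal.aemeasurable
    (ae_of_all _ fun z => (ENNReal.ofReal_pos.2
      (div_pos (P.weight_pos z) (P.integral_weight_pos hint))).ne')

end Normalization

section Chain

variable [SFinite νΘ]

/-- The outcome distributions, as a kernel in the decision. -/
noncomputable def outcome : Kernel X Θ :=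
  Kernel.withDensity (Kernel.const X νΘ) fun x θ => ENNReal.ofReal (P.density x θ)

lemma outcome_apply (x : X) :
    P.outcome x = νΘ.withDensity fun θ => ENNReal.ofReal (P.density x θ) := by
  rw [outcome, Kernel.withDensity_apply _ P.measurable_density.ennreal_ofReal, Kernel.const_apply]

instance : IsMarkovKernel P.outcome := ⟨fun x => by
  rw [P.outcome_apply]
  exact isProbabilityMeasure_withDensity (P.lintegral_density x)⟩

lemma reference_absolutelyContinuous_outcome (x : X) : νΘ ≪ P.outcome x := by
  rw [P.outcome_apply]
  exact withDensity_absolutelyContinuous'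
    (P.measurable_density.comp measurable_prodMk_left).ennreal_ofReal.aemeasurable
    (ae_of_all _ fun θ => (ENNReal.ofReal_pos.2 (P.density_pos x θ)).ne')

variable [SFinite νX] (G : Proposal X νX)

/-- The Metropolis–Hastings chain on (decision, outcome) pairs: the new decision is proposed by `G`
and its outcome drawn afresh, so that only the utilities enter the acceptance probability. -/
noncomputable def mhChain : Kernel (X × Θ) (X × Θ) :=
  mhKernel (fun z => P.utility z.1 z.2) P.measurable_utility (candidateKernel G.kernel P.outcome)

instance : IsMarkovKernel (P.mhChain G) := by
  unfold mhChain; infer_instance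

/-- The law of the path of the Metropolis–Hastings chain which starts at the decision `x₀` and an
outcome of `x₀`. -/
noncomputable def pathLaw (x₀ : X) : Measure (ℕ → X × Θ) :=
  chainLaw ((Kernel.id ×ₖ P.outcome) x₀) (P.mhChain G)

instance (x₀ : X) : IsProbabilityMeasure (P.pathLaw G x₀) := by
  unfold pathLaw; infer_instance

lemma candidateKernel_outcome_apply (z : X × Θ) :
    candidateKernel G.kernel P.outcome z = (νX.prod νΘ).withDensity fun y =>
      ENNReal.ofReal (G.g y.1 z.1) * ENNReal.ofReal (P.density y.1 y.2) :=
  candidateKernel_proposal_apply G P.measurable_density.ennreal_ofReal P.outcome_apply z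

variable {G}

lemma invariant_aug (hG : G.Symmetric) : (P.mhChain G).Invariant (P.aug νX) := by
  have hg : Measurable fun w : (X × Θ) × (X × Θ) => G.g w.2.1 w.1.1 :=
    G.measurable.comp (f := fun w : (X × Θ) × (X × Θ) => (w.2.1, w.1.1)) (by fun_prop)
  have hp : Measurable fun w : (X × Θ) × (X × Θ) => P.density w.2.1 w.2.2 :=
    P.measurable_density.comp measurable_snd
  refine (isReversible_mhKernel P.measurable_utility (fun z => P.utility_pos z.1 z.2)
    (q := fun z y => ENNReal.ofReal (G.g y.1 z.1) * ENNReal.ofReal (P.density y.1 y.2))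
    (h := fun z y => ENNReal.ofReal (P.density z.1 z.2) * ENNReal.ofReal (P.density y.1 y.2) *
      ENNReal.ofReal (∫ w, P.weight w ∂(νX.prod νΘ))⁻¹ * ENNReal.ofReal (G.g y.1 z.1))
    (hg.ennreal_ofReal.mul hp.ennreal_ofReal) (P.candidateKernel_outcome_apply G)
    P.measurable_augDensity.ennreal_ofReal (fun z y => ?_) fun z y => ?_).invariant
  · rw [P.ofReal_augDensity]
    ring
  · rw [hG y.1 z.1]
    ring

lemma isIrreducible_candidateKernel_outcome (hirr : G.kernel.IsIrreducible νX) :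
    (candidateKernel G.kernel P.outcome).IsIrreducible (P.aug νX) :=
  isIrreducible_of_absolutelyContinuous
    (isIrreducible_candidateKernel hirr P.reference_absolutelyContinuous_outcome)
    (fun _ => Measure.AbsolutelyContinuous.rfl) (withDensity_absolutelyContinuous _ _)

variable [NeZero νX] (hint : Integrable P.weight (νX.prod νΘ))
include hint

lemma harrisRecurrent_mhChain (hG : G.Symmetric) (hirr : G.kernel.IsIrreducible νX) :
    HarrisRecurrent (P.mhChain G) (P.aug νX) := by
  have := P.isProbabilityMeasure_aug hint
  refine harrisRecurrent_mhKernel P.measurable_utility (fun z => P.utility_pos z.1 z.2)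
    (P.invariant_aug hG) (P.isIrreducible_candidateKernel_outcome hirr) fun z => ?_
  rw [P.candidateKernel_outcome_apply G]
  exact (withDensity_absolutelyContinuous _ _).trans (P.prod_absolutelyContinuous_aug hint)

lemma ae_tendsto_modeEstimate [TopologicalSpace X] [OpensMeasurableSpace X]
    [FirstCountableTopology X] (hG : G.Symmetric) (hirr : G.kernel.IsIrreducible νX)
    (hslice : ∀ x, Integrable (fun θ => P.weight (x, θ)) νΘ) {T : (n : ℕ) → (Fin n → X) → X}
    (hT : IsConsistentModeEstimator νX Θ T (P.margDensity νX)) {m : X}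
    (hm : IsMode P.expectedUtility m) (burn : ℕ) (x₀ : X) :
    ∀ᵐ x ∂P.pathLaw G x₀, Tendsto (fun N => modeEstimate T burn N x) atTop (𝓝 m) := by
  have := P.isProbabilityMeasure_aug hint
  exact hT.ae_tendsto (P.isMode_margDensity hint hm) (P.invariant_aug hG)
    (P.harrisRecurrent_mhChain hint hG hirr) (P.fst_aug hslice) _ burn

end Chain

end DecisionProblem

end DecisionProblem

namespace DefendAttackGame

variable {D A Θ : Type*} [MeasurableSpace D] [MeasurableSpace A] [MeasurableSpace Θ]
  {νΘ : Measure Θ} (G : DefendAttackGame D A Θ νΘ)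

/-- The problem of the Attacker facing the defense `d`. -/
def attackerProblem (huA : ∀ a θ, 0 < G.uA a θ) (hpA : ∀ d a θ, 0 < G.pA d a θ) (d : D) :
    DecisionProblem A Θ νΘ where
  utility := G.uA
  density := G.pA d
  measurable_utility := G.measurable_uA
  measurable_density :=
    G.measurable_pA.comp (f := fun z : A × Θ => ((d, z.1), z.2)) (by fun_prop)
  utility_pos := huA
  density_pos := hpA d
  lintegral_density := G.lintegral_pA d

/-- The problem of the Defender whose defenses are met by the responses in the table `r`. -/
def defenderProblem (huD : ∀ d θ, 0 < G.uD d θ) (hpD : ∀ d a θ, 0 < G.pD d a θ) (r : D → A)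
    (hr : Measurable r) : DecisionProblem D Θ νΘ where
  utility := G.uD
  density d := G.pD d (r d)
  measurable_utility := G.measurable_uD
  measurable_density :=
    G.measurable_pD.comp (f := fun z : D × Θ => ((z.1, r z.1), z.2)) (by fun_prop)
  utility_pos := huD
  density_pos d := hpD d (r d)
  lintegral_density d := G.lintegral_pD d (r d)

variable [SFinite νΘ]

section Inner

variable (huA : ∀ a θ, 0 < G.uA a θ) (hpA : ∀ d a θ, 0 < G.pA d a θ) {νA : Measure A}
  [SFinite νA] (gA : Proposal A νA) (d : D)

lemma outcomeA_comap_eq_outcome :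
    G.outcomeA.comap (fun a => (d, a)) measurable_prodMk_left =
      (G.attackerProblem huA hpA d).outcome := by
  ext1 a
  rw [Kernel.comap_apply, outcomeA, Kernel.withDensity_apply _ G.measurable_pA.ennreal_ofReal,
    Kernel.const_apply, DecisionProblem.outcome_apply]
  rfl

lemma innerKernel_eq_mhChain : G.innerKernel gA d = (G.attackerProblem huA hpA d).mhChain gA := by
  rw [innerKernel, innerCandidate, G.outcomeA_comap_eq_outcome huA hpA]
  rfl

lemma innerLaw_eq_pathLaw (a₀ : A) :
    G.innerLaw gA d a₀ = (G.attackerProblem huA hpA d).pathLaw gA a₀ := by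
  have hinit : (G.outcomeA (d, a₀)).map (fun θ => (a₀, θ)) =
      (Kernel.id ×ₖ (G.attackerProblem huA hpA d).outcome) a₀ := by
    rw [← G.outcomeA_comap_eq_outcome huA hpA, Kernel.prod_apply, Kernel.id_apply,
      Measure.dirac_prod]
    rfl
  simp only [innerLaw, hinit, G.innerKernel_eq_mhChain huA hpA, DecisionProblem.pathLaw]

instance (a₀ : A) : IsProbabilityMeasure (G.innerLaw gA d a₀) := by
  have : IsProbabilityMeasure ((G.outcomeA (d, a₀)).map fun θ => (a₀, θ)) :=
    Measure.isProbabilityMeasure_map (by fun_prop)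
  unfold innerLaw; infer_instance

variable {gA d}

lemma responseLaw_eq_dirac [TopologicalSpace A] [T2Space A] [Nonempty A]
    {TA : (n : ℕ) → (Fin n → A) → A} {K : ℕ} {a₀ : D → A} {m : A}
    (hm : ∀ᵐ x ∂G.innerLaw gA d (a₀ d),
      Tendsto (fun M => modeEstimate TA K M x) atTop (𝓝 m)) :
    G.responseLaw gA TA K a₀ d = Measure.dirac m := by
  have hlim : (fun x => limUnder atTop fun M => modeEstimate TA K M x)
      =ᵐ[G.innerLaw gA d (a₀ d)] fun _ => m := hm.mono fun _ hx => hx.limUnder_eq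
  rw [responseLaw, Measure.map_congr hlim, Measure.map_const, measure_univ, one_smul]

end Inner

section Outer

variable (huD : ∀ d θ, 0 < G.uD d θ) (hpD : ∀ d a θ, 0 < G.pD d a θ) {νD : Measure D}
  [SFinite νD] (gD : Proposal D νD) {r : D → A} (hr : Measurable r)

lemma attachOutcome_deterministic :
    G.attachOutcome (Kernel.deterministic r hr) =
      Kernel.id ×ₖ (G.defenderProblem huD hpD r hr).outcome := by
  have houtcome : G.outcomeD ∘ₖ (Kernel.id ×ₖ Kernel.deterministic r hr) =
      (G.defenderProblem huD hpD r hr).outcome := by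
    ext1 d
    rw [Kernel.comp_apply, Kernel.prod_apply, Kernel.id_apply, Kernel.deterministic_apply,
      Measure.dirac_prod_dirac, Measure.dirac_bind (Kernel.measurable _), outcomeD,
      Kernel.withDensity_apply _ G.measurable_pD.ennreal_ofReal, Kernel.const_apply,
      DecisionProblem.outcome_apply]
    rfl
  rw [attachOutcome, houtcome]

lemma outerKernel_eq_mhChain :
    G.outerKernel gD (Kernel.deterministic r hr) =
      (G.defenderProblem huD hpD r hr).mhChain gD := by
  rw [outerKernel, outerCandidate, G.attachOutcome_deterministic huD hpD]
  rfl

lemma outerLaw_eq_pathLaw (d₀ : D) :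
    G.outerLaw gD (Kernel.deterministic r hr) d₀ =
      (G.defenderProblem huD hpD r hr).pathLaw gD d₀ := by
  simp only [outerLaw, G.attachOutcome_deterministic huD hpD,
    G.outerKernel_eq_mhChain huD hpD, DecisionProblem.pathLaw]

end Outer

end DefendAttackGame

theorem proposition1_general
    {D A Θ : Type*}
    [TopologicalSpace D] [MeasurableSpace D] [OpensMeasurableSpace D] [FirstCountableTopology D]
    [TopologicalSpace A] [MeasurableSpace A] [OpensMeasurableSpace A] [FirstCountableTopology A]
    [T2Space A] [Nonempty A] [MeasurableSpace Θ]
    (νD : Measure D) (νA : Measure A) (νΘ : Measure Θ) [SFinite νD] [SFinite νA] [SFinite νΘ]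
    (G : DefendAttackGame D A Θ νΘ)
    (huA : ∀ a θ, 0 < G.uA a θ) (huD : ∀ d θ, 0 < G.uD d θ)
    (hpA : ∀ d a θ, 0 < G.pA d a θ) (hpD : ∀ d a θ, 0 < G.pD d a θ)
    (astar : D → A) (hastar_meas : Measurable astar)
    (hastar : ∀ d a, a ≠ astar d → G.psiA d a < G.psiA d (astar d))
    (dGT : D) (hdGT : ∀ d, d ≠ dGT → G.psiD d (astar d) < G.psiD dGT (astar dGT))
    (hintA : ∀ d a, Integrable (fun θ => G.uA a θ * G.pA d a θ) νΘ)
    (hintD : ∀ d, Integrable (fun θ => G.uD d θ * G.pD d (astar d) θ) νΘ)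
    (hintA' : ∀ d, Integrable (fun z : A × Θ => G.uA z.1 z.2 * G.pA d z.1 z.2) (νA.prod νΘ))
    (hintD' : Integrable (fun z : D × Θ => G.uD z.1 z.2 * G.pD z.1 (astar z.1) z.2)
      (νD.prod νΘ))
    (gA : Proposal A νA) (gD : Proposal D νD) (hgA : gA.Symmetric) (hgD : gD.Symmetric)
    (hirrA : gA.kernel.IsIrreducible νA) (hirrD : gD.kernel.IsIrreducible νD)
    (TA : (n : ℕ) → (Fin n → A) → A) (TD : (n : ℕ) → (Fin n → D) → D)
    (hTA : ∀ d, IsConsistentModeEstimator νA Θ TA (G.margDensityA νA d))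
    (hTD : IsConsistentModeEstimator νD Θ TD (G.margDensityD νD astar))
    (K R : ℕ) (a₀ : D → A) :
    (∀ d, IsProbabilityMeasure (G.augA νA d) ∧
      (G.innerKernel gA d).Invariant (G.augA νA d) ∧
      IsMode (G.margDensityA νA d) (astar d) ∧
      ∀ᵐ x ∂(G.innerLaw gA d (a₀ d)),
        Tendsto (fun M => modeEstimate TA K M x) atTop (𝓝 (astar d))) ∧
    (∀ r : D → A, ∀ hr : Measurable r,
      Integrable (fun z : D × Θ => G.uD z.1 z.2 * G.pD z.1 (r z.1) z.2) (νD.prod νΘ) →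
      IsProbabilityMeasure (G.augD νD r) ∧
      (G.outerKernel gD (Kernel.deterministic r hr)).Invariant (G.augD νD r)) ∧
    ∃ (solve : Kernel D A) (_ : IsMarkovKernel solve),
      (∀ d, solve d = G.responseLaw gA TA K a₀ d) ∧
      IsProbabilityMeasure (G.augD νD astar) ∧
      (G.outerKernel gD solve).Invariant (G.augD νD astar) ∧
      IsMode (G.margDensityD νD astar) dGT ∧
      ∀ d₀ : D, ∀ᵐ x ∂(G.outerLaw gD solve d₀),
        Tendsto (fun N => modeEstimate TD R N x) atTop (𝓝 dGT) := by
  have : Nonempty D := ⟨dGT⟩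
  have : NeZero νA := ⟨gA.reference_ne_zero⟩
  have : NeZero νD := ⟨gD.reference_ne_zero⟩
  let PA := G.attackerProblem huA hpA
  let PD := G.defenderProblem huD hpD
  have hinner : ∀ d, ∀ᵐ x ∂(G.innerLaw gA d (a₀ d)),
      Tendsto (fun M => modeEstimate TA K M x) atTop (𝓝 (astar d)) := fun d => by
    rw [G.innerLaw_eq_pathLaw huA hpA]
    exact (PA d).ae_tendsto_modeEstimate (hintA' d) hgA hirrA (hintA d) (hTA d) (hastar d) K _
  have houter : ∀ r (hr : Measurable r),
      (G.outerKernel gD (Kernel.deterministic r hr)).Invariant (G.augD νD r) := fun r hr => by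
    rw [G.outerKernel_eq_mhChain huD hpD]
    exact (PD r hr).invariant_aug hgD
  refine ⟨fun d => ⟨(PA d).isProbabilityMeasure_aug (hintA' d), ?_,
      (PA d).isMode_margDensity (hintA' d) (hastar d), hinner d⟩,
    fun r hr hint => ⟨(PD r hr).isProbabilityMeasure_aug hint, houter r hr⟩,
    Kernel.deterministic astar hastar_meas, inferInstance,
    fun d => (G.responseLaw_eq_dirac (hinner d)).symm,
    (PD astar hastar_meas).isProbabilityMeasure_aug hintD', houter astar hastar_meas,
    (PD astar hastar_meas).isMode_margDensity hintD' hdGT, fun d₀ => ?_⟩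
  · rw [G.innerKernel_eq_mhChain huA hpA]
    exact (PA d).invariant_aug hgA
  · rw [G.outerLaw_eq_pathLaw huD hpD]
    exact (PD astar hastar_meas).ae_tendsto_modeEstimate hintD' hgD hirrD hintD hTD hdGT R d₀

theorem proposition1
    {D A Θ : Type*}
    [TopologicalSpace D] [MeasurableSpace D] [BorelSpace D]
    [TopologicalSpace A] [MeasurableSpace A] [BorelSpace A] [Nonempty A]
    [TopologicalSpace Θ] [MeasurableSpace Θ] [BorelSpace Θ]
    (νD : Measure D) (νA : Measure A) (νΘ : Measure Θ)
    -- the sets `𝒟`, `𝒜`, `Θ` are discrete or intervals in `ℝⁿ`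
    [DiscreteOrInterval D νD] [DiscreteOrInterval A νA] [DiscreteOrInterval Θ νΘ]
    (G : DefendAttackGame D A Θ νΘ)
    -- positivity of utilities and outcome densities
    (huA : ∀ a θ, 0 < G.uA a θ) (huD : ∀ d θ, 0 < G.uD d θ)
    (hpA : ∀ d a θ, 0 < G.pA d a θ) (hpD : ∀ d a θ, 0 < G.pD d a θ)
    -- the best response `a*` of the Attacker and the optimal defense `d*_GT`
    (astar : D → A) (hastar_meas : Measurable astar)
    (hastar : ∀ d a, a ≠ astar d → G.psiA d a < G.psiA d (astar d))
    (dGT : D) (hdGT : ∀ d, d ≠ dGT → G.psiD d (astar d) < G.psiD dGT (astar dGT))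
    -- integrability of the products of utilities and probabilities
    (hintA : ∀ d a, Integrable (fun θ => G.uA a θ * G.pA d a θ) νΘ)
    (hintD : ∀ d a, Integrable (fun θ => G.uD d θ * G.pD d a θ) νΘ)
    (hintA' : ∀ d, Integrable (fun z : A × Θ => G.uA z.1 z.2 * G.pA d z.1 z.2) (νA.prod νΘ))
    (hintD' : Integrable (fun z : D × Θ => G.uD z.1 z.2 * G.pD z.1 (astar z.1) z.2)
      (νD.prod νΘ))
    -- symmetric proposals, whose own Markov chains are irreducible
    (gA : Proposal A νA) (gD : Proposal D νD) (hgA : gA.Symmetric) (hgD : gD.Symmetric)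
    (hirrA : gA.kernel.IsIrreducible νA) (hirrD : gD.kernel.IsIrreducible νD)
    -- consistent mode estimators for the inner and the outer samples
    (TA : (n : ℕ) → (Fin n → A) → A) (TD : (n : ℕ) → (Fin n → D) → D)
    (hTA : ∀ d, IsConsistentModeEstimator νA Θ TA (G.margDensityA νA d))
    (hTD : IsConsistentModeEstimator νD Θ TD (G.margDensityD νD astar))
    -- burn-in lengths, and initial attacks of the inner chains
    (K R : ℕ) (a₀ : D → A) :
    -- the inner chains have stationary distribution `π_A(· ∣ d)`, and the estimated responses
    -- converge to `a*(d)` almost surely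
    (∀ d, IsProbabilityMeasure (G.augA νA d) ∧
      (G.innerKernel gA d).Invariant (G.augA νA d) ∧
      IsMode (G.margDensityA νA d) (astar d) ∧
      ∀ᵐ x ∂(G.innerLaw gA d (a₀ d)),
        Tendsto (fun M => modeEstimate TA K M x) atTop (𝓝 (astar d))) ∧
    -- for every table `r` of recorded responses, the outer chain has stationary distribution
    -- `π_D(d, θ ∣ r(d))`
    (∀ r : D → A, ∀ hr : Measurable r,
      Integrable (fun z : D × Θ => G.uD z.1 z.2 * G.pD z.1 (r z.1) z.2) (νD.prod νΘ) →
      IsProbabilityMeasure (G.augD νD r) ∧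
      (G.outerKernel gD (Kernel.deterministic r hr)).Invariant (G.augD νD r)) ∧
    -- the nested chain, in which each response is computed by its inner chain
    ∃ (solve : Kernel D A) (_ : IsMarkovKernel solve),
      (∀ d, solve d = G.responseLaw gA TA K a₀ d) ∧
      IsProbabilityMeasure (G.augD νD astar) ∧
      (G.outerKernel gD solve).Invariant (G.augD νD astar) ∧
      IsMode (G.margDensityD νD astar) dGT ∧
      ∀ d₀ : D, ∀ᵐ x ∂(G.outerLaw gD solve d₀),
        Tendsto (fun N => modeEstimate TD R N x) atTop (𝓝 dGT) := by
  have := DiscreteOrInterval.metrizableSpace νD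
  have := DiscreteOrInterval.metrizableSpace νA
  exact proposition1_general νD νA νΘ G huA huD hpA hpD astar hastar_meas hastar dGT hdGT hintA
    (fun d => hintD d (astar d)) hintA' hintD' gA gD hgA hgD hirrA hirrD TA TD hTA hTD K R a₀
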